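/- **Search in a star with a directional prediction and tolerance $H$.** For integers $k\ge 1$ let $\rho^*_k=\frac{k^k}{(k-1)^{k-1}}$ (with $0^0=1$, so $\rho^*_1=1$). Consider a star of $m$ rays indexed by $\mathbb Z/m\mathbb Z$ with common origin $O$. A strategy $X=(x_i,u_i)_{i\ge 0}$ with $x_i>0$ visits, in iteration $i$, ray $u_i$ up to distance $x_i$ and returns to $O$. A target at distance $d\ge 1$ on ray $u$ is found in the first iteration $i$ with $u_i=u$ and $x_i\ge d$, at cost $2\sum_{j<i}x_j+d$ (cost $\infty$ if there is no such $i$). For a predicted ray $h$ and a tolerance $H$, the *competitive ratio* of a strategy (for $h$ and $H$) is the supremum of cost$/d$ over all targets on the rays $h-H,\dots,h+H$ (indices mod $m$); its *robustness* is the supremum of cost$/d$ over all targets on all rays. **Theorem.** 1. For every $A>0$ there is a constant $C>0$, depending only on $A$, such that for all integers $H\ge 1$ and $m\ge 2H+1$, every predicted ray $h$ and every real $\tilde c>\rho^*_{2H+1}$ with $\tilde c-\rho^*_{2H+1}\le A\min\{\rho^*_{2H+1},\,m-2H\}$, there is a strategy with competitive ratio at most $1+2\tilde c$ and robustness at most $C\,\dfrac{\rho^*_{2H+1}}{\tilde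 c-\rho^*_{2H+1}}\,(m-2H)$. 2. This is asymptotically tight: there is an absolute constant $\kappa>0$ such that for all integers $H\ge 0$ and $m\ge 2H+2$, every predicted ray $h$ and every real $\tilde c>\rho^*_{2H+1}$, every strategy with competitive ratio at most $1+2\tilde c$ has robustness at least $\kappa\,\dfrac{\rho^*_{2H+1}}{\tilde c-\rho^*_{2H+1}}\,(m-2H)$. -/

import Mathlib

open scoped ENNReal

/-- The optimal constant `ρ*_k = k^k / (k-1)^(k-1)` of searching in a star of `k ≥ 1` rays
(with the convention `0^0 = 1`, so that `ρ*_1 = 1`); `1 + 2 ρ*_k` is the optimal competitive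
ratio of `k`-ray search. -/
noncomputable def rhoStar (k : ℕ) : ℝ :=
  (k : ℝ) ^ k / ((k : ℝ) - 1) ^ (k - 1)

/-- A search strategy in the star with `m ≥ 1` rays, the rays being indexed by residues mod `m`:
in iteration `i = 0, 1, 2, …` the searcher starts at the origin, walks on the ray `ray i` up to
distance `len i`, and goes back to the origin. -/
structure SearchStrategy (m : ℕ) where
  len : ℕ → ℝ
  ray : ℕ → ZMod m
  len_pos : ∀ i, 0 < len i

namespace SearchStrategy

variable {m : ℕ}

/-- Iteration `i` reaches the point at distance `d` on the ray `u`. -/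
def Reaches (X : SearchStrategy m) (u : ZMod m) (d : ℝ) (i : ℕ) : Prop :=
  X.ray i = u ∧ d ≤ X.len i

/-- The distance travelled by the searcher until the target at distance `d` on the ray `u` is
found: if `i` is the first iteration that reaches the target, this is
`2 * (len 0 + ⋯ + len (i-1)) + d`. (This expression increases with `i`, so that the infimum over
all iterations reaching the target is the value at the first one.) It is `∞` if the target is
never found. -/
noncomputable def searchCost (X : SearchStrategy m) (u : ZMod m) (d : ℝ) : ℝ≥0∞ :=
  ⨅ (i : ℕ) (_ : X.Reaches u d i), ENNReal.ofReal (2 * ∑ j ∈ Finset.range i, X.len j + d)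

/-- The competitive ratio of a strategy against the targets on the rays in `R` (at distance at
least `1` from the origin). -/
noncomputable def competitiveRatioOn (X : SearchStrategy m) (R : Set (ZMod m)) : ℝ≥0∞ :=
  ⨆ (u : ZMod m) (_ : u ∈ R) (d : ℝ) (_ : 1 ≤ d), X.searchCost u d / ENNReal.ofReal d

/-- The rays within (cyclic) distance `H` of the predicted ray `h`: the cyclic interval from
`h - H mod m` to `h + H mod m`. -/
def tolerated (h : ZMod m) (H : ℕ) : Set (ZMod m) :=
  {u | ∃ k : ℤ, |k| ≤ (H : ℤ) ∧ u = h + (k : ZMod m)}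

/-- The competitive ratio of the strategy chosen for the predicted ray `h`, if the target is on a
ray within distance `H` of `h`. -/
noncomputable def toleranceRatio (X : SearchStrategy m) (h : ZMod m) (H : ℕ) : ℝ≥0∞ :=
  X.competitiveRatioOn (tolerated h H)

/-- The competitive ratio of the strategy if the prediction is adversarial, i.e. the target may be
on any ray. -/
noncomputable def robustness (X : SearchStrategy m) : ℝ≥0∞ :=
  X.competitiveRatioOn Set.univ

end SearchStrategy

/-! Lower bound: let `T` consist of `k = 2H+1` tolerated rays, and let `S p` be the infimum of the
total length of `p` records on `T`. Given `p` records, the longest of length `x`, consider on each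
ray of `T` the first walk beyond `x`. The latest of these starts after a total length `D ≤ c * x`,
and before it come the `p` records and the other `k - 1` first walks. Robustness `1 + 2 * r` forces
each of the `m - k` other rays to be searched up to `D / r` by then, so these `p + k - 1` records
have total length at most `c' * x`, where `c' = c * (1 - (m - k) / r)` (`exists_records_sum_le`).
Bounding `x` by what its removal saves gives `S (i + k) ≤ c' * (S (i + 1) - S i)` for large `i`, and
this forces `ρ*_k ≤ c'` (`rhoStar_le_of_recurrence`), a lower bound on `r`.

Upper bound: `twoSpeed` interleaves the optimal geometric search of the tolerated rays with walks on
the `n = m - k` other rays, scaled by `δ`. With `δ` of order `ε / (n + 1)`, where `ε = c - ρ*_k`,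
the tolerated rays lose at most `ε`, and the others are slower by a factor of order `1 / δ`. -/

/-! ### The constant `ρ*_k` and the recurrence that forces it -/

/-- Bernoulli's inequality around `g = k / (k - 1)`, where `g ^ k / (g - 1)` attains its minimum
`ρ*_k`. -/
theorem rhoStar_mul_sub_one_le_pow {k : ℕ} (hk : 1 ≤ k) {g : ℝ} (hg : 1 ≤ g) :
    rhoStar k * (g - 1) ≤ g ^ k := by
  obtain ⟨l, rfl⟩ : ∃ l, k = l + 1 := ⟨k - 1, by omega⟩
  rcases Nat.eq_zero_or_pos l with rfl | hl
  · simp [rhoStar]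
  · have hl' : (0 : ℝ) < l := by exact_mod_cast hl
    have hx : -2 ≤ g * l / (l + 1) - 1 := by
      have : 0 ≤ g * l / (l + 1) := by positivity
      linarith
    have h := one_add_mul_le_pow hx (l + 1)
    have e1 : 1 + ((l + 1 : ℕ) : ℝ) * (g * l / (l + 1) - 1) = l * (g - 1) := by
      push_cast; field_simp; ring
    have e2 : (1 + (g * l / (l + 1) - 1)) ^ (l + 1) = g ^ (l + 1) * l ^ (l + 1) / (l + 1) ^ (l + 1) := by
      rw [add_sub_cancel, div_pow, mul_pow]
    rw [e1, e2, le_div_iff₀ (by positivity)] at h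
    have e3 : rhoStar (l + 1) * (g - 1) = (l * (g - 1) * (l + 1) ^ (l + 1)) / l ^ (l + 1) := by
      simp only [rhoStar, Nat.add_sub_cancel, Nat.cast_add, Nat.cast_one, add_sub_cancel_right]
      field_simp
      ring
    rw [e3, div_le_iff₀ (by positivity)]
    exact h

theorem rhoStar_pos {k : ℕ} (hk : 1 ≤ k) : 0 < rhoStar k := by
  obtain ⟨l, rfl⟩ : ∃ l, k = l + 1 := ⟨k - 1, by omega⟩
  rcases Nat.eq_zero_or_pos l with rfl | hl
  · simp [rhoStar]
  · have hl' : (0 : ℝ) < l := by exact_mod_cast hl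
    simp only [rhoStar, Nat.add_sub_cancel, Nat.cast_add, Nat.cast_one, add_sub_cancel_right]
    positivity

/-- The infimum `g` of the growth ratios satisfies `g ^ k ≤ c * (g - 1)`: bounding `S (i + k)` below
by `g ^ (k - 1) * S (i + 1)` turns the recurrence into a lower bound on every ratio, hence on `g`
itself. -/
theorem rhoStar_le_of_recurrence {k : ℕ} (hk : 1 ≤ k) {S : ℕ → ℝ} {c : ℝ}
    (hpos : ∀ i, 0 < S i) (hmono : Monotone S)
    (hrec : ∀ i, S (i + k) ≤ c * (S (i + 1) - S i)) : rhoStar k ≤ c := by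
  have hc : 0 < c := by
    by_contra hc
    have h1 := hmono (Nat.le_succ 0)
    have h2 := hrec 0
    have h3 := hpos (0 + k)
    simp only [Nat.succ_eq_add_one] at h1
    nlinarith
  have hbdd : BddBelow (Set.range fun i => S (i + 1) / S i) :=
    ⟨0, by rintro _ ⟨i, rfl⟩; exact div_nonneg (hpos _).le (hpos _).le⟩
  set g : ℝ := ⨅ i, S (i + 1) / S i with hgdef
  have hg1 : 1 ≤ g := le_ciInf fun i => by
    rw [one_le_div (hpos i)]; exact hmono (Nat.le_succ i)
  have hg : ∀ i, g * S i ≤ S (i + 1) := fun i => by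
    rw [← le_div_iff₀ (hpos i)]; exact ciInf_le hbdd i
  have hgpow : ∀ j i, g ^ j * S i ≤ S (i + j) := fun j => by
    induction j with
    | zero => intro i; simp
    | succ j ih =>
      intro i
      calc g ^ (j + 1) * S i = g * (g ^ j * S i) := by ring
        _ ≤ g * S (i + j) := by gcongr; exact ih i
        _ ≤ S (i + (j + 1)) := hg (i + j)
  have hq : ∀ i, c * S i ≤ (c - g ^ (k - 1)) * S (i + 1) := fun i => by
    have h1 := hgpow (k - 1) (i + 1)
    rw [show i + 1 + (k - 1) = i + k by omega] at h1
    have h2 := hrec i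
    linarith
  have hcg : 0 < c - g ^ (k - 1) :=
    pos_of_mul_pos_left ((mul_pos hc (hpos 0)).trans_le (hq 0)) (hpos 1).le
  have hfin : c / (c - g ^ (k - 1)) ≤ g := le_ciInf fun i => by
    rw [div_le_div_iff₀ hcg (hpos i)]
    linarith [hq i]
  rw [div_le_iff₀ hcg] at hfin
  have hgk : g ^ k = g * g ^ (k - 1) := by
    rw [← pow_succ']; congr 1; omega
  have hgc : g ^ k ≤ c * (g - 1) := by rw [hgk]; linarith
  have hgpos : 0 < g ^ k := by positivity
  have hg1' : 0 < g - 1 := pos_of_mul_pos_right (hgpos.trans_le hgc) hc.le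
  exact le_of_mul_le_mul_right ((rhoStar_mul_sub_one_le_pow hk hg1).trans hgc) hg1'

/-! ### Records and the lower bound -/

namespace SearchStrategy

variable {m : ℕ}

theorem competitiveRatioOn_le_iff (X : SearchStrategy m) (R : Set (ZMod m)) {c : ℝ}
    (hc : 0 ≤ 1 + 2 * c) :
    X.competitiveRatioOn R ≤ ENNReal.ofReal (1 + 2 * c) ↔
      ∀ u ∈ R, ∀ d : ℝ, 1 ≤ d → ∃ i, X.Reaches u d i ∧ ∑ j ∈ Finset.range i, X.len j ≤ c * d := by
  simp only [competitiveRatioOn, iSup_le_iff]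
  refine forall₄_congr fun u _ d hd => ?_
  have hd0 : 0 < d := by linarith
  rw [ENNReal.div_le_iff (by simpa using hd0) (by simp), ← ENNReal.ofReal_mul hc]
  constructor
  · intro h
    classical
    have hex : ∃ i, X.Reaches u d i := by
      by_contra hne
      push Not at hne
      simp [searchCost, hne] at h
    refine ⟨Nat.find hex, Nat.find_spec hex, ?_⟩
    have hle : ENNReal.ofReal (2 * ∑ j ∈ Finset.range (Nat.find hex), X.len j + d)
        ≤ X.searchCost u d := le_iInf₂ fun i hi => by
      refine ENNReal.ofReal_le_ofReal ?_
      gcongr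
      · intro j _ _; exact (X.len_pos j).le
      · exact Nat.find_min' hex hi
    have := (ENNReal.ofReal_le_ofReal_iff (by positivity)).1 (hle.trans h)
    linarith
  · rintro ⟨i, hi, hle⟩
    refine (iInf₂_le i hi).trans (ENNReal.ofReal_le_ofReal ?_)
    linarith

/-- The iterations on rays in `T` that reach distance at least `1` and go further than all earlier
iterations on the same ray. -/
def records (X : SearchStrategy m) (T : Finset (ZMod m)) : Set ℕ :=
  {j | X.ray j ∈ T ∧ 1 ≤ X.len j ∧ ∀ i < j, X.ray i = X.ray j → X.len i < X.len j}

theorem sum_len_strictMono (X : SearchStrategy m) :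
    StrictMono fun i => ∑ j ∈ Finset.range i, X.len j :=
  strictMono_nat_of_lt_succ fun i => by
    rw [Finset.sum_range_succ]; linarith [X.len_pos i]

/-- The first iteration on a ray that goes beyond `d` is a record, precedes no record on this ray of
length at most `d`, and starts by time `c * d`. -/
theorem exists_record_gt (X : SearchStrategy m) {T : Finset (ZMod m)} {c : ℝ} (hc : 0 < c)
    {u : ZMod m} (hu : u ∈ T)
    (hX : ∀ d : ℝ, 1 ≤ d → ∃ i, X.Reaches u d i ∧ ∑ j ∈ Finset.range i, X.len j ≤ c * d)
    {d : ℝ} (hd : 1 ≤ d) :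
    ∃ t ∈ X.records T, X.ray t = u ∧ d < X.len t ∧ ∑ j ∈ Finset.range t, X.len j ≤ c * d ∧
      ∀ j ∈ X.records T, X.ray j = u → X.len j ≤ d → j < t := by
  classical
  have hex : ∃ t, X.ray t = u ∧ d < X.len t := by
    obtain ⟨i, ⟨h1, h2⟩, _⟩ := hX (d + 1) (by linarith)
    exact ⟨i, h1, by linarith⟩
  obtain ⟨h1, h2⟩ := Nat.find_spec hex
  have hmin : ∀ i < Nat.find hex, X.ray i = u → X.len i ≤ d := fun i hi hiu => by
    have := Nat.find_min hex hi
    by_contra hlt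
    exact this ⟨hiu, not_le.1 hlt⟩
  refine ⟨Nat.find hex, ⟨h1.symm ▸ hu, by linarith, fun i hi hiu => ?_⟩, h1, h2, ?_, ?_⟩
  · exact (hmin i hi (hiu.trans h1)).trans_lt h2
  -- A target at `e > d` cannot be found before the first walk beyond `d`; now let `e` tend to `d`.
  · have : ∀ e, d < e → ∑ j ∈ Finset.range (Nat.find hex), X.len j ≤ c * e := fun e he => by
      obtain ⟨i, ⟨hi1, hi2⟩, hi3⟩ := hX e (by linarith)
      exact (X.sum_len_strictMono.monotone
        (Nat.find_min' hex ⟨hi1, he.trans_le hi2⟩)).trans hi3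
    rw [← div_le_iff₀' hc]
    exact le_of_forall_gt_imp_ge_of_dense fun e he => (div_le_iff₀' hc).2 (this e he)
  · intro j hj hju hjd
    by_contra hlt
    rcases (not_lt.1 hlt).eq_or_lt with h | h
    · rw [h] at h2; linarith
    · have := hj.2.2 _ h (h1.trans hju.symm)
      linarith

/-- The exchange step behind the recurrence: `Q` adds to `P` the first walks beyond `X.len a` on all
rays of `T` but the one where this happens last. -/
theorem exists_records_sum_le [NeZero m] (X : SearchStrategy m) {T : Finset (ZMod m)}
    (hT : T.Nonempty) {c r : ℝ} (hc : 0 < c) (hr : 0 < r)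
    (hXT : ∀ u ∈ T, ∀ d : ℝ, 1 ≤ d →
      ∃ i, X.Reaches u d i ∧ ∑ j ∈ Finset.range i, X.len j ≤ c * d)
    (hX : ∀ u, ∀ d : ℝ, 1 ≤ d →
      ∃ i, X.Reaches u d i ∧ ∑ j ∈ Finset.range i, X.len j ≤ r * d)
    {P : Finset ℕ} (hP : ↑P ⊆ X.records T) {a : ℕ} (ha : a ∈ P)
    (hmax : ∀ j ∈ P, X.len j ≤ X.len a) (hrP : r ≤ P.card) :
    ∃ Q : Finset ℕ, ↑Q ⊆ X.records T ∧ Q.card + 1 = P.card + T.card ∧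
      ∑ j ∈ Q, X.len j ≤ c * (1 - ((m : ℝ) - T.card) / r) * X.len a := by
  classical
  have ha1 : 1 ≤ X.len a := (hP ha).2.1
  have H := fun u : T => X.exists_record_gt hc u.2 (hXT u u.2) ha1
  choose t htJ htu htlt htc htP using H
  have : Nonempty T := hT.to_subtype
  obtain ⟨v, hv⟩ := Finite.exists_max t
  have hinj : Function.Injective t := fun x y hxy => by
    apply Subtype.ext; rw [← htu x, hxy, htu y]
  set D := ∑ j ∈ Finset.range (t v), X.len j with hD
  let N := (Finset.univ.erase v).image t
  have hNcard : N.card + 1 = T.card := by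
    rw [Finset.card_image_of_injective _ hinj, Finset.card_erase_add_one (Finset.mem_univ v)]
    simp
  have hdisj : Disjoint P N := by
    rw [Finset.disjoint_left]
    intro j hj hjN
    obtain ⟨u, _, rfl⟩ := Finset.mem_image.1 hjN
    exact absurd (hmax _ hj) (not_le.2 (htlt u))
  have hQJ : ((P ∪ N : Finset ℕ) : Set ℕ) ⊆ X.records T := by
    intro j hj
    rcases Finset.mem_union.1 (Finset.mem_coe.1 hj) with h | h
    · exact hP h
    · obtain ⟨u, _, rfl⟩ := Finset.mem_image.1 h
      exact htJ u
  have hQt : ∀ j ∈ P ∪ N, j < t v := by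
    intro j hj
    rcases Finset.mem_union.1 hj with h | h
    · exact (htP ⟨_, (hP h).1⟩ j (hP h) rfl (hmax j h)).trans_le (hv _)
    · obtain ⟨u, hu, rfl⟩ := Finset.mem_image.1 h
      exact (hv u).lt_of_ne fun e => (Finset.mem_erase.1 hu).1 (hinj e)
  refine ⟨P ∪ N, hQJ, by rw [Finset.card_union_of_disjoint hdisj]; omega, ?_⟩
  -- Records have length at least 1, so `P.card ≥ r` makes `D / r ≥ 1` an admissible target
  -- distance.
  have hPD : (P.card : ℝ) ≤ D := by
    calc (P.card : ℝ) = ∑ j ∈ P, (1 : ℝ) := by simp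
      _ ≤ ∑ j ∈ P, X.len j := Finset.sum_le_sum fun j hj => (hP hj).2.1
      _ ≤ D := Finset.sum_le_sum_of_subset_of_nonneg
        (fun j hj => Finset.mem_range.2 (hQt j (Finset.mem_union_left _ hj)))
        fun j _ _ => (X.len_pos j).le
  have hDr : 1 ≤ D / r := by rw [one_le_div hr]; linarith
  -- A target at `D / r` must be found by an iteration starting no later than `t v`; equality is
  -- excluded because `t v` walks on a ray of `T`.
  have H2 : ∀ u : (Tᶜ : Finset (ZMod m)), ∃ l, l < t v ∧ X.ray l = u ∧ D / r ≤ X.len l := fun u => by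
    obtain ⟨i, ⟨hi1, hi2⟩, hi3⟩ := hX u (D / r) hDr
    rw [mul_div_cancel₀ _ hr.ne'] at hi3
    refine ⟨i, (X.sum_len_strictMono.le_iff_le.1 hi3).lt_of_ne fun e => ?_, hi1, hi2⟩
    have h1 : X.ray i ∈ T := by rw [e, htu v]; exact v.2
    rw [hi1] at h1
    exact Finset.mem_compl.1 u.2 h1
  choose l hlt hlu hlen using H2
  have hlinj : Function.Injective l := fun x y hxy => by
    apply Subtype.ext; rw [← hlu x, hxy, hlu y]
  have hdisj2 : Disjoint (P ∪ N) (Finset.univ.image l) := by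
    rw [Finset.disjoint_left]
    intro j hj hjl
    obtain ⟨u, _, rfl⟩ := Finset.mem_image.1 hjl
    have h1 := (hQJ hj).1
    rw [hlu] at h1
    exact Finset.mem_compl.1 u.2 h1
  have hcompl : ((Tᶜ : Finset (ZMod m)).card : ℝ) = (m : ℝ) - T.card := by
    rw [Finset.card_compl, ZMod.card, Nat.cast_sub]
    simpa [ZMod.card] using Finset.card_le_univ T
  have hsum : ∑ j ∈ P ∪ N, X.len j + ((m : ℝ) - T.card) * (D / r) ≤ D := by
    calc ∑ j ∈ P ∪ N, X.len j + ((m : ℝ) - T.card) * (D / r)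
        ≤ ∑ j ∈ P ∪ N, X.len j + ∑ j ∈ Finset.univ.image l, X.len j := by
          gcongr
          rw [Finset.sum_image hlinj.injOn, ← hcompl, ← nsmul_eq_mul]
          have := Finset.card_nsmul_le_sum Finset.univ (fun u => X.len (l u)) (D / r)
            fun u _ => hlen u
          simpa using this
      _ = ∑ j ∈ (P ∪ N) ∪ Finset.univ.image l, X.len j := (Finset.sum_union hdisj2).symm
      _ ≤ D := Finset.sum_le_sum_of_subset_of_nonneg (fun j hj => by
          rw [Finset.mem_range]
          rcases Finset.mem_union.1 hj with h | h
          · exact hQt j h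
          · obtain ⟨u, _, rfl⟩ := Finset.mem_image.1 h
            exact hlt u) fun j _ _ => (X.len_pos j).le
  have hDc : D ≤ c * X.len a := htc v
  have hQ0 : 0 ≤ ∑ j ∈ P ∪ N, X.len j := Finset.sum_nonneg fun j _ => (X.len_pos j).le
  have hD0 : 0 < D := by
    have := (one_le_div hr).1 hDr
    linarith
  have hfac : ∑ j ∈ P ∪ N, X.len j ≤ D * (1 - ((m : ℝ) - T.card) / r) := by
    calc _ ≤ D - ((m : ℝ) - T.card) * (D / r) := by linarith
      _ = _ := by ring
  have hfac0 : 0 ≤ 1 - ((m : ℝ) - T.card) / r :=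
    nonneg_of_mul_nonneg_right (hQ0.trans hfac) hD0
  calc _ ≤ D * (1 - ((m : ℝ) - T.card) / r) := hfac
    _ ≤ c * X.len a * (1 - ((m : ℝ) - T.card) / r) := by gcongr
    _ = _ := by ring

theorem records_infinite (X : SearchStrategy m) {T : Finset (ZMod m)} {u : ZMod m} (hu : u ∈ T)
    {c : ℝ} (hc : 0 < c)
    (hX : ∀ d : ℝ, 1 ≤ d → ∃ i, X.Reaches u d i ∧ ∑ j ∈ Finset.range i, X.len j ≤ c * d) :
    (X.records T).Infinite := by
  intro hfin
  obtain ⟨b, hb⟩ := (hfin.image X.len).bddAbove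
  obtain ⟨t, htJ, -, hlt, -⟩ := X.exists_record_gt hc hu hX (le_max_left 1 b)
  have := hb (Set.mem_image_of_mem _ htJ)
  exact absurd ((le_max_right 1 b).trans_lt hlt) (not_lt.2 this)

/-- If the rays in `T` are searched with competitive ratio `1 + 2 * c` and all `m` rays with ratio
`1 + 2 * r`, then `T` is searched as if the walks on `T` were longer by the factor
`1 / (1 - (m - |T|) / r)`. -/
theorem rhoStar_card_le [NeZero m] (X : SearchStrategy m) {T : Finset (ZMod m)}
    (hT : T.Nonempty) {c r : ℝ} (hc : 0 < c) (hr : 0 < r)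
    (hXT : ∀ u ∈ T, ∀ d : ℝ, 1 ≤ d →
      ∃ i, X.Reaches u d i ∧ ∑ j ∈ Finset.range i, X.len j ≤ c * d)
    (hX : ∀ u, ∀ d : ℝ, 1 ≤ d →
      ∃ i, X.Reaches u d i ∧ ∑ j ∈ Finset.range i, X.len j ≤ r * d) :
    rhoStar T.card ≤ c * (1 - ((m : ℝ) - T.card) / r) := by
  classical
  obtain ⟨u, hu⟩ := hT
  have hinf := X.records_infinite hu hc (hXT u hu)
  let V : ℕ → Type := fun p => {P : Finset ℕ // ↑P ⊆ X.records T ∧ P.card = p}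
  have hne : ∀ p, Nonempty (V p) := fun p => by
    obtain ⟨P, h1, h2⟩ := hinf.exists_subset_card_eq p
    exact ⟨⟨P, h1, h2⟩⟩
  let S : ℕ → ℝ := fun p => ⨅ P : V p, ∑ j ∈ P.1, X.len j
  have hbdd : ∀ p, BddBelow (Set.range fun P : V p => ∑ j ∈ P.1, X.len j) := fun p =>
    ⟨0, by rintro _ ⟨P, rfl⟩; exact Finset.sum_nonneg fun j _ => (X.len_pos j).le⟩
  have hS : ∀ Q : Finset ℕ, ↑Q ⊆ X.records T → S Q.card ≤ ∑ j ∈ Q, X.len j := fun Q hQ =>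
    ciInf_le (hbdd _) (⟨Q, hQ, rfl⟩ : V Q.card)
  have hSp : ∀ p : ℕ, (p : ℝ) ≤ S p := fun p => le_ciInf fun P => by
    calc (p : ℝ) = ∑ j ∈ P.1, (1 : ℝ) := by simp [P.2.2]
      _ ≤ _ := Finset.sum_le_sum fun j hj => (P.2.1 hj).2.1
  have herase : ∀ p, ∀ P : V (p + 1), ∀ a ∈ P.1, S p ≤ ∑ j ∈ P.1, X.len j - X.len a :=
    fun p P a ha => by
      have h1 := hS (P.1.erase a) fun j hj => P.2.1 (Finset.mem_of_mem_erase hj)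
      rw [Finset.card_erase_of_mem ha, P.2.2, Nat.add_sub_cancel] at h1
      have h2 := Finset.add_sum_erase P.1 X.len ha
      linarith
  have hcard : ∀ p, ∀ P : V (p + 1), P.1.Nonempty := fun p P => by
    rw [← Finset.card_pos, P.2.2]; omega
  have hmono : Monotone S := monotone_nat_of_le_succ fun p => le_ciInf fun P => by
    obtain ⟨a, ha⟩ := hcard p P
    linarith [herase p P a ha, X.len_pos a]
  have hk : 1 ≤ T.card := Finset.card_pos.2 ⟨u, hu⟩
  set c' := c * (1 - ((m : ℝ) - T.card) / r) with hc'
  obtain ⟨N, hN⟩ := exists_nat_ge (r + 1)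
  have hrec : ∀ i, N ≤ i → S (i + T.card) ≤ c' * (S (i + 1) - S i) := fun i hi => by
    have hkey : ∀ P : V (i + 1), S (i + T.card) ≤ c' * (∑ j ∈ P.1, X.len j - S i) ∧ 0 ≤ c' :=
      fun P => by
        obtain ⟨a, ha, hmax⟩ := P.1.exists_max_image X.len (hcard i P)
        have hrP : r ≤ P.1.card := by
          have : (N : ℝ) ≤ i := by exact_mod_cast hi
          rw [P.2.2]; push_cast; linarith
        obtain ⟨Q, hQJ, hQc, hQs⟩ :=
          X.exists_records_sum_le ⟨u, hu⟩ hc hr hXT hX P.2.1 ha hmax hrP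
        have hQc' : Q.card = i + T.card := by have := P.2.2; omega
        have h1 := hS Q hQJ
        rw [hQc'] at h1
        have h2 : S (i + T.card) ≤ c' * X.len a := h1.trans hQs
        have hc0 : 0 ≤ c' := by
          have h3 := hSp (i + T.card)
          have h4 : (0 : ℝ) ≤ (i + T.card : ℕ) := Nat.cast_nonneg _
          exact nonneg_of_mul_nonneg_left (h4.trans (h3.trans h2)) (X.len_pos a)
        refine ⟨h2.trans ?_, hc0⟩
        gcongr
        linarith [herase i P a ha]
    have hc0 : 0 < c' := by
      obtain ⟨P⟩ := hne (i + 1)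
      obtain ⟨h1, h2⟩ := hkey P
      refine h2.lt_of_ne fun e => ?_
      rw [← e, zero_mul] at h1
      have h3 := hSp (i + T.card)
      have h4 : (0 : ℝ) < (i + T.card : ℕ) := by exact_mod_cast (by omega)
      linarith
    -- The infimum `S (i + 1)` need not be attained, so the bound is put in a form that passes to
    -- the infimum over `P`.
    have : S (i + T.card) / c' + S i ≤ S (i + 1) := le_ciInf fun P => by
      have := (div_le_iff₀' hc0).2 (hkey P).1
      linarith
    rw [← div_le_iff₀' hc0]
    linarith
  -- The shift skips the indices where the recurrence is not available, and `S 0`, which is not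
  -- positive.
  refine rhoStar_le_of_recurrence hk (S := fun i => S (i + (N + 1))) (fun i => ?_)
    (fun i j hij => hmono (by omega)) fun i => ?_
  · have := hSp (i + (N + 1))
    push_cast at this
    have h1 : (0 : ℝ) ≤ i := Nat.cast_nonneg _
    have h2 : (0 : ℝ) ≤ N := Nat.cast_nonneg _
    linarith
  · have := hrec (i + (N + 1)) (by omega)
    rw [show i + T.card + (N + 1) = i + (N + 1) + T.card by omega,
      show i + 1 + (N + 1) = i + (N + 1) + 1 by omega]
    exact this

theorem exists_finset_tolerated {H : ℕ} (hm : 2 * H + 1 ≤ m) (h : ZMod m) :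
    ∃ T : Finset (ZMod m), ↑T ⊆ tolerated h H ∧ T.card = 2 * H + 1 := by
  classical
  refine ⟨(Finset.range (2 * H + 1)).image fun a : ℕ => h + (((a : ℤ) - H : ℤ) : ZMod m), ?_, ?_⟩
  · intro u hu
    simp only [Finset.coe_image, Set.mem_image, Finset.coe_range, Set.mem_Iio] at hu
    obtain ⟨a, ha, rfl⟩ := hu
    exact ⟨a - H, by rw [abs_le]; omega, rfl⟩
  · rw [Finset.card_image_of_injOn, Finset.card_range]
    intro a ha b hb hab
    simp only [Finset.coe_range, Set.mem_Iio] at ha hb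
    simp only [Int.cast_sub, Int.cast_natCast, add_right_inj, sub_left_inj] at hab
    rw [ZMod.natCast_eq_natCast_iff', Nat.mod_eq_of_lt (by omega), Nat.mod_eq_of_lt (by omega)] at hab
    exact hab

theorem le_robustness {H : ℕ} (hm : 2 * H + 2 ≤ m) {c : ℝ} (hc : rhoStar (2 * H + 1) < c)
    (h : ZMod m) (X : SearchStrategy m)
    (hX : X.toleranceRatio h H ≤ ENNReal.ofReal (1 + 2 * c)) :
    ENNReal.ofReal
      (1 / 2 * (rhoStar (2 * H + 1) / (c - rhoStar (2 * H + 1)) * ((m : ℝ) - 2 * (H : ℝ))))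
      ≤ X.robustness := by
  have : NeZero m := ⟨by omega⟩
  have hρ : 0 < rhoStar (2 * H + 1) := rhoStar_pos (by omega)
  set ρ := rhoStar (2 * H + 1) with hρdef
  have hε : 0 < c - ρ := by linarith
  have hc0 : 0 < c := hρ.trans hc
  have hn : (2 * H + 2 : ℝ) ≤ m := by exact_mod_cast hm
  set R := 1 / 2 * (ρ / (c - ρ) * ((m : ℝ) - 2 * (H : ℝ))) with hR
  have hR0 : 0 < R := by
    have : 0 < (m : ℝ) - 2 * H := by linarith
    positivity
  by_contra hlt
  have hrob : X.robustness ≤ ENNReal.ofReal (1 + 2 * (R / 2)) :=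
    (not_le.1 hlt).le.trans (ENNReal.ofReal_le_ofReal (by linarith))
  have h1 := (X.competitiveRatioOn_le_iff _ (by linarith)).1 hrob
  have h2 := (X.competitiveRatioOn_le_iff _ (by linarith)).1 hX
  obtain ⟨T, hTt, hTc⟩ := exists_finset_tolerated (H := H) (by omega) h
  have h3 := X.rhoStar_card_le (T := T) (Finset.card_pos.1 (by omega)) hc0 (half_pos hR0)
    (fun u hu => h2 u (hTt hu)) (fun u => h1 u (Set.mem_univ u))
  rw [hTc, ← hρdef] at h3
  push_cast at h3
  have h4 : c * (((m : ℝ) - (2 * H + 1)) / (R / 2)) ≤ c - ρ := by linarith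
  rw [← mul_div_assoc, div_le_iff₀ (half_pos hR0), hR] at h4
  have h5 : (c - ρ) * (1 / 2 * (ρ / (c - ρ) * ((m : ℝ) - 2 * H)) / 2) = ρ * ((m : ℝ) - 2 * H) / 4 := by
    field_simp; ring
  rw [h5] at h4
  -- Contradiction with `h4`, since `m ≥ 2H+2` gives `m - (2H+1) ≥ (m - 2H) / 2`.
  have h6 : ρ * ((m : ℝ) - (2 * H + 1)) < c * ((m : ℝ) - (2 * H + 1)) :=
    mul_lt_mul_of_pos_right hc (by linarith)
  nlinarith


/-! ### The two-speed strategy and the upper bound -/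

/-- The cyclic search, starting with the ray `v`, of `m = n + k` rays: in each round, the first `n`
rays are searched up to the same distance, growing by the factor `b ^ k` from round to round, and
the other `k` rays up to distances that grow by the factor `b` from ray to ray. -/
noncomputable def twoSpeed (n k : ℕ) (v : ZMod m) {δ b : ℝ} (hδ : 0 < δ) (hb : 0 < b) :
    SearchStrategy m where
  len i := if i % m < n then δ * (b ^ k) ^ (i / m) else b ^ (i / m * k + (i % m - n))
  ray i := v + i
  len_pos i := by split_ifs <;> positivity

variable {n k : ℕ}

theorem twoSpeed_len_of_lt (hm : m = n + k) (v : ZMod m) {δ b : ℝ} (hδ : 0 < δ)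
    (hb : 0 < b) (s : ℕ) {t : ℕ} (ht : t < n) :
    (twoSpeed n k v hδ hb).len (s * m + t) = δ * (b ^ k) ^ s := by
  have h1 : (s * m + t) % m = t := by
    rw [Nat.mul_comm, Nat.mul_add_mod, Nat.mod_eq_of_lt (by omega)]
  have h2 : (s * m + t) / m = s := by
    rw [Nat.mul_comm, Nat.mul_add_div (by omega), Nat.div_eq_of_lt (by omega), Nat.add_zero]
  simp only [twoSpeed, h1, h2, ht, if_true]

theorem twoSpeed_len_add (hm : m = n + k) (v : ZMod m) {δ b : ℝ} (hδ : 0 < δ)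
    (hb : 0 < b) (s : ℕ) {a : ℕ} (ha : a < k) :
    (twoSpeed n k v hδ hb).len (s * m + n + a) = b ^ (s * k + a) := by
  have h1 : (s * m + n + a) % m = n + a := by
    rw [Nat.mul_comm, Nat.add_assoc, Nat.mul_add_mod, Nat.mod_eq_of_lt (by omega)]
  have h2 : (s * m + n + a) / m = s := by
    rw [Nat.mul_comm, Nat.add_assoc, Nat.mul_add_div (by omega), Nat.div_eq_of_lt (by omega),
      Nat.add_zero]
  simp [twoSpeed, h1, h2]

/-- Both geometric series are extended to all negative exponents. The closed forms `b ^ j / (b - 1)`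
and `n * δ * B ^ s / (B - 1)`, with `B = b ^ k`, then grow exactly by the walks added, so induction
applies. -/
theorem sum_twoSpeed_len_le (hm : m = n + k) (hk : 0 < k) (v : ZMod m) {δ b : ℝ} (hδ : 0 < δ)
    (hb : 1 < b) (hb0 : 0 < b) (s : ℕ) :
    (∀ t ≤ n, ∑ j ∈ Finset.range (s * m + t), (twoSpeed n k v hδ hb0).len j ≤
      b ^ (s * k) / (b - 1) + n * δ * (b ^ k) ^ s / (b ^ k - 1) + t * (δ * (b ^ k) ^ s)) ∧
    (∀ a ≤ k, ∑ j ∈ Finset.range (s * m + n + a), (twoSpeed n k v hδ hb0).len j ≤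
      b ^ (s * k + a) / (b - 1) + n * δ * (b ^ k) ^ (s + 1) / (b ^ k - 1)) := by
  have hb1 : 0 < b - 1 := by linarith
  have hB1 : 0 < b ^ k - 1 := by
    have := one_lt_pow₀ hb hk.ne'
    linarith
  have step : ∀ s : ℕ, (∑ j ∈ Finset.range (s * m), (twoSpeed n k v hδ hb0).len j ≤
      b ^ (s * k) / (b - 1) + n * δ * (b ^ k) ^ s / (b ^ k - 1)) →
      (∀ t ≤ n, ∑ j ∈ Finset.range (s * m + t), (twoSpeed n k v hδ hb0).len j ≤
        b ^ (s * k) / (b - 1) + n * δ * (b ^ k) ^ s / (b ^ k - 1) + t * (δ * (b ^ k) ^ s)) ∧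
      (∀ a ≤ k, ∑ j ∈ Finset.range (s * m + n + a), (twoSpeed n k v hδ hb0).len j ≤
        b ^ (s * k + a) / (b - 1) + n * δ * (b ^ k) ^ (s + 1) / (b ^ k - 1)) := by
    intro s hs
    have h1 : ∀ t ≤ n, ∑ j ∈ Finset.range (s * m + t), (twoSpeed n k v hδ hb0).len j ≤
        b ^ (s * k) / (b - 1) + n * δ * (b ^ k) ^ s / (b ^ k - 1) + t * (δ * (b ^ k) ^ s) := by
      intro t
      induction t with
      | zero => intro _; simpa using hs
      | succ t ih =>
        intro ht
        rw [← Nat.add_assoc, Finset.sum_range_succ, twoSpeed_len_of_lt hm v hδ hb0 s (by omega)]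
        have := ih (by omega)
        push_cast
        linarith
    refine ⟨h1, fun a => ?_⟩
    induction a with
    | zero =>
      intro _
      refine (h1 n le_rfl).trans (le_of_eq ?_)
      field_simp
      ring
    | succ a ih =>
      intro ha
      rw [← Nat.add_assoc, Finset.sum_range_succ, twoSpeed_len_add hm v hδ hb0 s (by omega)]
      have := ih (by omega)
      have e : b ^ (s * k + (a + 1)) / (b - 1) = b ^ (s * k + a) / (b - 1) + b ^ (s * k + a) := by
        field_simp
        ring
      linarith
  refine step s ?_
  induction s with
  | zero =>
    have : 0 ≤ b ^ (0 * k) / (b - 1) + n * δ * (b ^ k) ^ 0 / (b ^ k - 1) := by positivity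
    simpa using this
  | succ s ih =>
    have := (step s ih).2 k le_rfl
    rwa [show s * m + n + k = (s + 1) * m by rw [hm]; ring,
      show s * k + k = (s + 1) * k by ring] at this

theorem exists_first_pow_ge {B x d : ℝ} (hB : 1 < B) (hx : 0 < x) :
    ∃ s : ℕ, d ≤ x * B ^ s ∧ (s = 0 ∨ ∃ s', s = s' + 1 ∧ x * B ^ s' < d) := by
  classical
  have hex : ∃ s : ℕ, d ≤ x * B ^ s := by
    obtain ⟨s, hs⟩ := pow_unbounded_of_one_lt (d / x) hB
    exact ⟨s, by rw [div_lt_iff₀' hx] at hs; exact hs.le⟩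
  refine ⟨Nat.find hex, Nat.find_spec hex, ?_⟩
  rcases h : Nat.find hex with _ | s'
  · exact Or.inl rfl
  · exact Or.inr ⟨s', rfl, not_le.1 (Nat.find_min hex (by omega))⟩

/-- The `k` rays that are searched faster: competitive ratio at most `1 + 2 * (b ^ k / (b - 1) + ε)`. -/
theorem twoSpeed_reaches_add (hm : m = n + k) (hk : 0 < k) (v : ZMod m) {δ b ε : ℝ} (hδ : 0 < δ)
    (hb : 1 < b) (hb0 : 0 < b) (hB : 2 ≤ b ^ k) (hB' : b ^ k ≤ 5) (hε : n * δ * 8 ≤ ε)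
    {a : ℕ} (ha : a < k) {d : ℝ} (hd : 1 ≤ d) :
    ∃ i, (twoSpeed n k v hδ hb0).Reaches (v + (n + a : ℕ)) d i ∧
      ∑ j ∈ Finset.range i, (twoSpeed n k v hδ hb0).len j ≤ (b ^ k / (b - 1) + ε) * d := by
  have hb1 : 0 < b - 1 := by linarith
  obtain ⟨s, hs, hs'⟩ := exists_first_pow_ge (B := b ^ k) (d := d) (by linarith) (pow_pos hb0 a)
  have hpow : ∀ s : ℕ, b ^ (s * k + a) = b ^ a * (b ^ k) ^ s := fun s => by
    rw [pow_add, mul_comm s k, pow_mul]; ring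
  have hnδ : 0 ≤ n * δ := by positivity
  have hd0 : 0 < d := by linarith
  refine ⟨s * m + n + a, ⟨?_, ?_⟩, ?_⟩
  · simp [twoSpeed, add_assoc]
  · rwa [twoSpeed_len_add hm v hδ hb0 s ha, hpow]
  · refine ((sum_twoSpeed_len_le hm hk v hδ hb hb0 s).2 a ha.le).trans ?_
    rw [add_mul]
    rw [hpow]
    have hak : b ^ a ≤ b ^ k := pow_le_pow_right₀ hb.le ha.le
    generalize b ^ k = B at *
    have hB1 : 0 < B - 1 := by linarith
    rcases hs' with rfl | ⟨s', rfl, hlt⟩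
    · have h1 : b ^ a * B ^ 0 / (b - 1) ≤ B / (b - 1) * d := by
        rw [pow_zero, mul_one, ← mul_one (b ^ a / (b - 1))]
        gcongr
      have h2 : n * δ * B ^ (0 + 1) / (B - 1) ≤ ε * d := by
        have h3 : B / (B - 1) ≤ 8 := by
          rw [div_le_iff₀ hB1]; linarith
        calc n * δ * B ^ (0 + 1) / (B - 1) = n * δ * (B / (B - 1)) * 1 := by ring
          _ ≤ n * δ * 8 * d := by gcongr
          _ ≤ ε * d := by gcongr
      linarith
    · have h1 : b ^ a * B ^ (s' + 1) / (b - 1) ≤ B / (b - 1) * d := by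
        rw [show b ^ a * B ^ (s' + 1) / (b - 1) = B / (b - 1) * (b ^ a * B ^ s') by ring]
        gcongr
      have h2 : n * δ * B ^ (s' + 1 + 1) / (B - 1) ≤ ε * d := by
        -- The factor 8 comes from here: `B ^ 2 ≤ 8 * (B - 1)` holds on `[2, 5]`.
        have h3 : B ^ 2 / (B - 1) ≤ 8 := by
          rw [div_le_iff₀ hB1]; nlinarith
        have h4 : B ^ s' ≤ d := by
          have : 1 ≤ b ^ a := one_le_pow₀ hb.le
          have : B ^ s' ≤ b ^ a * B ^ s' := le_mul_of_one_le_left (by positivity) this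
          linarith
        calc n * δ * B ^ (s' + 1 + 1) / (B - 1) = n * δ * (B ^ 2 / (B - 1)) * B ^ s' := by ring
          _ ≤ n * δ * 8 * d := by gcongr
          _ ≤ ε * d := by gcongr
      linarith

/-- The `n` rays that are searched slower. -/
theorem twoSpeed_reaches_of_lt (hm : m = n + k) (hk : 0 < k) (v : ZMod m) {δ b : ℝ} (hδ : 0 < δ)
    (hb : 1 < b) (hb0 : 0 < b) (hB : 2 ≤ b ^ k) (hB' : b ^ k ≤ 5)
    {t : ℕ} (ht : t < n) {d : ℝ} (hd : 1 ≤ d) :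
    ∃ i, (twoSpeed n k v hδ hb0).Reaches (v + (t : ℕ)) d i ∧
      ∑ j ∈ Finset.range i, (twoSpeed n k v hδ hb0).len j ≤
        (b ^ k / (b - 1) / δ + b ^ k / (b - 1) + 8 * (n * (1 + δ))) * d := by
  have hb1 : 0 < b - 1 := by linarith
  obtain ⟨s, hs, hs'⟩ := exists_first_pow_ge (B := b ^ k) (d := d) (by linarith) hδ
  have hpow : b ^ (s * k) = (b ^ k) ^ s := by
    rw [mul_comm s k, pow_mul]
  have hd0 : 0 < d := by linarith
  refine ⟨s * m + t, ⟨?_, ?_⟩, ?_⟩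
  · simp [twoSpeed]
  · rwa [twoSpeed_len_of_lt hm v hδ hb0 s ht]
  · refine ((sum_twoSpeed_len_le hm hk v hδ hb hb0 s).1 t ht.le).trans ?_
    rw [hpow]
    generalize b ^ k = B at *
    have hB1 : 0 < B - 1 := by linarith
    have htn : (t : ℝ) ≤ n := by exact_mod_cast ht.le
    have h0 : n * δ * B ^ s / (B - 1) + t * (δ * B ^ s) ≤ n * (δ * B ^ s * (B / (B - 1))) := by
      calc _ ≤ n * δ * B ^ s / (B - 1) + n * (δ * B ^ s) := by gcongr
        _ = _ := by field_simp; ring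
    rcases hs' with rfl | ⟨s', rfl, hlt⟩
    · have h1 : B ^ 0 / (b - 1) ≤ B / (b - 1) * d := by
        rw [pow_zero, ← mul_one (1 / (b - 1))]
        gcongr
        linarith
      have h3 : B / (B - 1) ≤ 8 := by
        rw [div_le_iff₀ hB1]; linarith
      have h2 : n * (δ * B ^ 0 * (B / (B - 1))) ≤ 8 * (n * δ) * d := by
        calc _ = B / (B - 1) * (n * δ) * 1 := by ring
          _ ≤ 8 * (n * δ) * d := by gcongr
      have h4 : 0 ≤ B / (b - 1) / δ * d := by positivity
      have h5 : 0 ≤ n * d := by positivity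
      linarith
    · have h1 : B ^ (s' + 1) / (b - 1) ≤ B / (b - 1) / δ * d := by
        rw [show B ^ (s' + 1) / (b - 1) = B / (b - 1) / δ * (δ * B ^ s') by field_simp; ring]
        gcongr
      have h3 : B ^ 2 / (B - 1) ≤ 8 := by
        rw [div_le_iff₀ hB1]; nlinarith
      have h2 : n * (δ * B ^ (s' + 1) * (B / (B - 1))) ≤ 8 * n * d := by
        calc _ = B ^ 2 / (B - 1) * n * (δ * B ^ s') := by ring
          _ ≤ 8 * n * d := by gcongr
      have h4 : 0 ≤ B / (b - 1) := by positivity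
      have h5 : 0 ≤ B / (b - 1) * d := by positivity
      have h6 : 0 ≤ n * δ * d := by positivity
      nlinarith

/-- The minimizer `b = k / (k - 1)` of `b ^ k / (b - 1)`; its `k`-th power is at most `3 * (3 / 2)`,
as `(1 + 1 / (k - 1)) ^ (k - 1) ≤ e`. -/
theorem exists_base_rhoStar {k : ℕ} (hk : 3 ≤ k) :
    ∃ b : ℝ, 1 < b ∧ 2 ≤ b ^ k ∧ b ^ k ≤ 5 ∧ b ^ k / (b - 1) = rhoStar k := by
  obtain ⟨l, rfl⟩ : ∃ l, k = l + 1 := ⟨k - 1, by omega⟩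
  have hl : (2 : ℝ) ≤ l := by exact_mod_cast (by omega : 2 ≤ l)
  have hl0 : (0 : ℝ) < l := by linarith
  have hinv : (l : ℝ)⁻¹ ≤ 1 / 2 := by
    rw [inv_eq_one_div]
    gcongr
  have hinv0 : 0 < (l : ℝ)⁻¹ := by positivity
  refine ⟨1 + (l : ℝ)⁻¹, by linarith, ?_, ?_, ?_⟩
  · have h := one_add_mul_le_pow (a := (l : ℝ)⁻¹) (by linarith) (l + 1)
    have e : ((l + 1 : ℕ) : ℝ) * (l : ℝ)⁻¹ = 1 + (l : ℝ)⁻¹ := by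
      push_cast; field_simp
    linarith
  · have h1 : (1 + (l : ℝ)⁻¹) ^ l ≤ 3 := by
      calc (1 + (l : ℝ)⁻¹) ^ l ≤ Real.exp (l : ℝ)⁻¹ ^ l := by
            gcongr
            linarith [Real.add_one_le_exp (l : ℝ)⁻¹]
        _ = Real.exp 1 := by rw [← Real.exp_nat_mul, mul_inv_cancel₀ hl0.ne']
        _ ≤ 3 := by linarith [Real.exp_one_lt_d9]
    rw [pow_succ]
    nlinarith
  · simp only [rhoStar, Nat.add_sub_cancel, Nat.cast_add, Nat.cast_one, add_sub_cancel_right,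
      add_sub_cancel_left]
    have e : 1 + (l : ℝ)⁻¹ = (l + 1) / l := by field_simp
    rw [e, div_pow]
    field_simp
    ring

theorem exists_strategy_le {A : ℝ} (hA : 0 < A) {H : ℕ} (hH : 1 ≤ H) (hm : 2 * H + 1 ≤ m) {c : ℝ}
    (hc : rhoStar (2 * H + 1) < c)
    (hcA : c - rhoStar (2 * H + 1) ≤ A * min (rhoStar (2 * H + 1)) ((m : ℝ) - 2 * (H : ℝ)))
    (h : ZMod m) :
    ∃ X : SearchStrategy m,
      X.toleranceRatio h H ≤ ENNReal.ofReal (1 + 2 * c) ∧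
      X.robustness ≤ ENNReal.ofReal
        ((2 * A ^ 2 + 20 * A + 32) *
          (rhoStar (2 * H + 1) / (c - rhoStar (2 * H + 1)) * ((m : ℝ) - 2 * (H : ℝ)))) := by
  obtain ⟨n, hmn⟩ : ∃ n, m = n + (2 * H + 1) := ⟨m - (2 * H + 1), by omega⟩
  have hρ : 0 < rhoStar (2 * H + 1) := rhoStar_pos (by omega)
  obtain ⟨b, hb, hB, hB', hbρ⟩ := exists_base_rhoStar (k := 2 * H + 1) (by omega)
  have hb0 : 0 < b := by linarith
  have hmn' : (m : ℝ) - 2 * H = n + 1 := by rw [hmn]; push_cast; ring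
  rw [hmn'] at hcA ⊢
  obtain ⟨ε, hε⟩ : ∃ ε, ε = c - rhoStar (2 * H + 1) := ⟨_, rfl⟩
  rw [← hε] at hcA ⊢
  have hcε : c = rhoStar (2 * H + 1) + ε := by linarith
  have hε0 : 0 < ε := by linarith
  generalize rhoStar (2 * H + 1) = ρ at *
  have hn0 : (0 : ℝ) ≤ n := Nat.cast_nonneg n
  have hn1 : (0 : ℝ) < n + 1 := by linarith
  have hεA : ε ≤ A * ρ := hcA.trans (by gcongr; exact min_le_left _ _)
  have hεA' : ε ≤ A * (n + 1) := hcA.trans (by gcongr; exact min_le_right _ _)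
  -- The largest scale, up to `n + 1` in place of `n`, for which the loss `8 * n * δ` on the
  -- tolerated rays stays within `ε`.
  obtain ⟨δ, hδ⟩ : ∃ δ, δ = ε / (8 * (n + 1)) := ⟨_, rfl⟩
  have hδ0 : 0 < δ := by rw [hδ]; positivity
  have hδε : (n + 1) * δ * 8 = ε := by rw [hδ]; field_simp
  -- Starting just after the tolerated interval puts its `2H+1` rays last in each round.
  set v : ZMod m := h + (H : ℕ) + 1 with hv
  have hfast : ∀ a < 2 * H + 1, ∀ d : ℝ, 1 ≤ d →
      ∃ i, (twoSpeed n (2 * H + 1) v hδ0 hb0).Reaches (v + (n + a : ℕ)) d i ∧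
      ∑ j ∈ Finset.range i, (twoSpeed n (2 * H + 1) v hδ0 hb0).len j ≤ c * d := by
    intro a ha d hd
    rw [hcε, ← hbρ]
    exact twoSpeed_reaches_add hmn (by omega) v hδ0 hb hb0 hB hB' (by linarith) ha hd
  have hRdef : ∃ R, R = ρ / ε * ((n : ℝ) + 1) := ⟨_, rfl⟩
  obtain ⟨R, hR⟩ := hRdef
  rw [← hR]
  have hRε : R * ε = ρ * (n + 1) := by rw [hR]; field_simp
  have hR0 : 0 < R := by rw [hR]; positivity
  -- The assumption on `ε` makes the lower-order terms `n + 1`, `ρ` and `ε` multiples of `R`, with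
  -- factors depending only on `A`.
  have hR1 : (n : ℝ) + 1 ≤ A * R := by
    refine le_of_mul_le_mul_right ?_ hε0
    rw [mul_assoc, hRε]; nlinarith
  have hR2 : ρ ≤ A * R := by
    refine le_of_mul_le_mul_right ?_ hε0
    rw [mul_assoc, hRε]; nlinarith
  have hR3 : ε ≤ A ^ 2 * R := by nlinarith
  have hcR : c ≤ ((2 * A ^ 2 + 20 * A + 32) * R - 1) / 2 := by nlinarith
  refine ⟨twoSpeed n (2 * H + 1) v hδ0 hb0, ?_, ?_⟩
  · refine (competitiveRatioOn_le_iff _ _ (by linarith)).2 ?_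
    rintro u ⟨z, hz, rfl⟩ d hd
    rw [abs_le] at hz
    obtain ⟨a, ha⟩ : ∃ a : ℕ, (a : ℤ) = z + H := ⟨(z + H).toNat, by omega⟩
    have := hfast a (by omega) d hd
    have e : v + (n + a : ℕ) = h + (z : ZMod m) := by
      have hz : z = a - H := by omega
      have hm0 : (n : ZMod m) + (2 * H + 1) = 0 := by
        have := ZMod.natCast_self m
        rw [hmn] at this ⊢
        exact_mod_cast this
      rw [hz, hv]
      push_cast
      linear_combination hm0
    rwa [e] at this
  · rw [show (2 * A ^ 2 + 20 * A + 32) * R = 1 + 2 * (((2 * A ^ 2 + 20 * A + 32) * R - 1) / 2) by ring]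
    refine (competitiveRatioOn_le_iff _ _ (by linarith)).2 ?_
    intro u _ d hd
    have : NeZero m := ⟨by omega⟩
    have htm := ZMod.val_lt (u - v)
    have hu : v + ((u - v).val : ℕ) = u := by
      rw [ZMod.natCast_zmod_val, add_sub_cancel]
    rw [← hu]
    have hd0 : 0 ≤ d := by linarith
    generalize (u - v).val = t at *
    rcases lt_or_ge t n with ht | ht
    · obtain ⟨i, hi, hle⟩ := twoSpeed_reaches_of_lt hmn (by omega) v hδ0 hb hb0 hB hB' ht hd
      refine ⟨i, hi, hle.trans ?_⟩
      rw [hbρ]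
      have h1 : ρ / δ = 8 * R := by rw [hδ, hR]; field_simp
      rw [h1]
      gcongr
      nlinarith
    · obtain ⟨i, hi, hle⟩ := hfast (t - n) (by omega) d hd
      rw [show n + (t - n) = t by omega] at hi
      exact ⟨i, hi, hle.trans (by gcongr)⟩

end SearchStrategy

theorem mainTheorem6 :
    -- upper bound
    (∀ A : ℝ, 0 < A → ∃ C : ℝ, 0 < C ∧
      ∀ H m : ℕ, 1 ≤ H → 2 * H + 1 ≤ m →
      ∀ c : ℝ, rhoStar (2 * H + 1) < c →
        c - rhoStar (2 * H + 1) ≤ A * min (rhoStar (2 * H + 1)) ((m : ℝ) - 2 * (H : ℝ)) →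
      ∀ h : ZMod m, ∃ X : SearchStrategy m,
        X.toleranceRatio h H ≤ ENNReal.ofReal (1 + 2 * c) ∧
        X.robustness ≤ ENNReal.ofReal
          (C * (rhoStar (2 * H + 1) / (c - rhoStar (2 * H + 1)) * ((m : ℝ) - 2 * (H : ℝ))))) ∧
    -- lower bound
    (∃ κ : ℝ, 0 < κ ∧
      ∀ H m : ℕ, 2 * H + 2 ≤ m →
      ∀ c : ℝ, rhoStar (2 * H + 1) < c →
      ∀ (h : ZMod m) (X : SearchStrategy m),
        X.toleranceRatio h H ≤ ENNReal.ofReal (1 + 2 * c) →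
        ENNReal.ofReal
          (κ * (rhoStar (2 * H + 1) / (c - rhoStar (2 * H + 1)) * ((m : ℝ) - 2 * (H : ℝ))))
          ≤ X.robustness) := by
  refine ⟨fun A hA => ⟨2 * A ^ 2 + 20 * A + 32, by positivity,
    fun H m hH hm c hc hcA h => SearchStrategy.exists_strategy_le hA hH hm hc hcA h⟩,
    1 / 2, by norm_num, fun H m hm c hc h X hX => SearchStrategy.le_robustness hm hc h X hX⟩
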